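/- Let $M$ be a von Neumann algebra with a faithful normal finite trace $\tau$, and let $L_2(M)=L_2(M,\tau)$ be the completion of $M$ for the inner product $\langle x,y\rangle=\tau(x^*y)$, on which $M$ acts by left multiplication and $M^{op}$ by right multiplication, $b^{op}\xi=\xi b$. Let $\mathcal A\subseteq M$ be a $\sigma$-weakly dense $*$-subalgebra whose norm closure $A$ contains $1_M$. Let $H$ be a Hilbert space with an $\mathcal A$-$\mathcal A$-bimodule structure, i.e. with $*$-homomorphisms $\mathcal A\to B(H)$ and $\mathcal A^{op}\to B(H)$ whose images commute (not assumed unital); we write $x\xi y$ for the resulting actions and $xy^{op}\in B(H)$ for the operator $\xi\mapsto x\xi y$. Let $\partial:\mathcal A\to H$ be a derivation, i.e. a linear map with $\partial(xy)=x\,\partial(y)+\partial(x)\,y$, that is closable as a densely defined operator from $L_2(M)$ to $H$. Assume that $\mathcal A$ has a countable linear basis $(e_i)_{i\in I}$ that is orthonormal in $L_2(M)$, and let $S:\mathcal A\to H$ be the linear map with $S(e_i)=\partial(e_i)/\|\partial(e_i)\|$ if $\partial(e_i)\neq 0$, and $S(e_i)=u_i$ for an arbitrary unit vector $u_i\in H$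 if $\partial(e_i)=0$. Denote by $A\otimes_{\min}A^{op}$ the C$^*$-algebra generated by the operators $a\otimes b^{op}$, $a,b\in A$, on $L_2(M)\otimes L_2(M)$. Suppose that 1. $S$ extends to a bounded operator $S:L_2(M)\to H$, and $S^*S$ is a Fredholm operator on $L_2(M)$; 2. for all $x,y\in\mathcal A$ the operator $T_{x,y}:L_2(M)\to H$, $T_{x,y}(\xi)=x\,S(\xi)\,y-S(x\xi y)$, is compact; 3. $H$ is weakly contained in the coarse bimodule of $M$ as an $\mathcal A$-$\mathcal A$-bimodule, i.e. the assignment $x\otimes y^{op}\in B(L_2(M)\otimes L_2(M))\mapsto xy^{op}\in B(H)$, $x,y\in\mathcal A$, extends to a bounded $*$-homomorphism $A\otimes_{\min}A^{op}\to B(H)$. Then there is a unital completely positive map $\theta:A\otimes_{\min}A^{op}\to B(L_2(M))$ such that $\theta(a\otimes b^{op})-ab^{op}$ is compact for all $a,b\in A$. -/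

import Mathlib

open scoped TensorProduct InnerProductSpace ComplexOrder CStarAlgebra

noncomputable section

/-! ### C⋆-subalgebras as ordered C⋆-algebras -/

/-- A norm closed unital ⋆-subalgebra of an ordered C⋆-algebra, with the inherited order, is
again an ordered C⋆-algebra: the positive elements are those of the form `s⋆ s`. -/
instance closedStarSubalgebra_starOrderedRing {B : Type*} [CStarAlgebra B] [PartialOrder B]
    [StarOrderedRing B] (S : StarSubalgebra ℂ B) [hS : IsClosed (S : Set B)] :
    StarOrderedRing S := by
  refine StarOrderedRing.of_nonneg_iff' (fun {x y} h z => ?_) (fun x => ⟨fun h => ?_, ?_⟩)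
  · exact add_le_add_right (α := B) (show (x : B) ≤ y from h) (z : B)
  · have h' : 0 ≤ (x : B) := h
    have hsa : IsSelfAdjoint x := Subtype.ext h'.isSelfAdjoint.star_eq
    have hq : SpectrumRestricts x ContinuousMap.realToNNReal := by
      rw [SpectrumRestricts.nnreal_iff]
      intro r hr
      have hr' : (algebraMap ℝ ℂ r) ∈ spectrum ℂ x := (spectrum.algebraMap_mem_iff ℂ).mpr hr
      rw [StarSubalgebra.spectrum_eq (S := S)] at hr'
      exact spectrum_nonneg_of_nonneg h' ((spectrum.algebraMap_mem_iff ℂ).mp hr')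
    obtain ⟨p, hp, -, hpp⟩ :=
      CFC.exists_sqrt_of_isSelfAdjoint_of_quasispectrumRestricts hsa hq
    exact ⟨p, by rw [hp.star_eq, hpp]⟩
  · rintro ⟨s, rfl⟩
    exact star_mul_self_nonneg (s : B)

/-! ### Von Neumann algebras with a trace and their standard Hilbert space -/

section Trace

variable {K : Type*} [NormedAddCommGroup K] [InnerProductSpace ℂ K] [CompleteSpace K]

/-- A von Neumann algebra is norm closed, hence a C⋆-algebra. -/
instance vonNeumann_isClosed (M : VonNeumannAlgebra K) :
    IsClosed (M.toStarSubalgebra : Set (K →L[ℂ] K)) := by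
  have h : (M.toStarSubalgebra : Set (K →L[ℂ] K)) =
      Set.centralizer (Set.centralizer (M.toStarSubalgebra : Set (K →L[ℂ] K))) :=
    M.centralizer_centralizer'.symm
  rw [h]
  exact Set.isClosed_centralizer _

variable (K) in
/-- The σ-weak (ultraweak) topology of `B(K)`: the initial topology for the functionals
`x ↦ ∑ₙ ⟨ξₙ, x ηₙ⟩` with `∑ₙ ‖ξₙ‖² < ∞` and `∑ₙ ‖ηₙ‖² < ∞`. -/
abbrev sigmaWeakTopology : TopologicalSpace (K →L[ℂ] K) :=
  ⨅ p : {p : (ℕ → K) × (ℕ → K) //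
      Summable (fun n => ‖p.1 n‖ ^ 2) ∧ Summable (fun n => ‖p.2 n‖ ^ 2)},
    TopologicalSpace.induced (fun x : K →L[ℂ] K => ∑' n, ⟪p.1.1 n, x (p.1.2 n)⟫_ℂ) inferInstance

/-- A faithful normal finite trace on a von Neumann algebra. -/
structure FaithfulNormalTrace (M : VonNeumannAlgebra K) where
  /-- the underlying positive linear functional -/
  toFun : M.toStarSubalgebra →ₚ[ℂ] ℂ
  tracial : ∀ x y, toFun (x * y) = toFun (y * x)
  faithful : ∀ x, toFun (star x * x) = 0 → x = 0
  normal : @Continuous _ _ ((sigmaWeakTopology K).induced Subtype.val) inferInstance toFun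

/-- A ⋆-subalgebra of `M` that is dense in `M` for the σ-weak topology. -/
def IsSigmaWeaklyDense {M : VonNeumannAlgebra K}
    (𝒜 : NonUnitalStarSubalgebra ℂ M.toStarSubalgebra) : Prop :=
  ∀ x : M.toStarSubalgebra,
    (x : K →L[ℂ] K) ∈ @closure _ (sigmaWeakTopology K) (Subtype.val '' (𝒜 : Set M.toStarSubalgebra))

namespace FaithfulNormalTrace

variable {M : VonNeumannAlgebra K} (τ : FaithfulNormalTrace M)

/-- The Hilbert space `L₂(M, τ)`: the completion of `M` for `⟨x, y⟩ = τ(x⋆ y)`. -/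
abbrev L2 : Type _ := τ.toFun.GNS

/-- The canonical map `M → L₂(M, τ)`, `x ↦ x Ω`, where `Ω` is the vector given by `1 ∈ M`. -/
def toL2 : M.toStarSubalgebra →ₗ[ℂ] τ.L2 where
  toFun x := ((τ.toFun.toPreGNS x : τ.toFun.PreGNS) : UniformSpace.Completion τ.toFun.PreGNS)
  map_add' x y := by rw [map_add, UniformSpace.Completion.coe_add]
  map_smul' c x := by rw [map_smul, UniformSpace.Completion.coe_smul]; rfl

/-- Left multiplication `λ(a) : x Ω ↦ a x Ω` on `L₂(M, τ)`. -/
def leftMul (a : M.toStarSubalgebra) : τ.L2 →L[ℂ] τ.L2 := τ.toFun.gnsStarAlgHom a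

lemma norm_mul_right_le (x b : M.toStarSubalgebra) :
    ‖τ.toFun.toPreGNS (x * b)‖ ≤ ‖b‖ * ‖τ.toFun.toPreGNS x‖ := by
  rw [← sq_le_sq₀ (by positivity) (by positivity), mul_pow, ← RCLike.ofReal_le_ofReal (K := ℂ),
    RCLike.ofReal_pow, RCLike.ofReal_eq_complex_ofReal, PositiveLinearMap.preGNS_norm_sq]
  have h1 : τ.toFun (star (x * b) * (x * b)) = τ.toFun (star (star x) * (star (star b) * star b) * star x) := by
    rw [τ.tracial]; simp only [star_mul, star_star, mul_assoc]
  have h2 : star (star x) * (star (star b) * star b) * star x ≤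
      ‖b‖ ^ 2 • (star (star x) * star x) := by
    have h := CStarAlgebra.star_left_conjugate_le_norm_smul (a := star x)
      (b := star (star b) * star b) (hb := IsSelfAdjoint.star_mul_self _)
    rwa [CStarRing.norm_star_mul_self, norm_star, ← sq] at h
  have h3 : τ.toFun (star (star x) * star x) = τ.toFun (star x * x) := by
    rw [star_star, τ.tracial]
  have h4 := OrderHomClass.mono τ.toFun h2
  have h5 : τ.toFun (‖b‖ ^ 2 • (star (star x) * star x)) =
      ((‖b‖ ^ 2 : ℝ) : ℂ) * τ.toFun (star x * x) := by
    rw [← h3, ← Complex.coe_smul, map_smul, smul_eq_mul]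
  simp only [PositiveLinearMap.ofPreGNS_toPreGNS]
  rw [h1]
  refine h4.trans (le_of_eq ?_)
  rw [h5]
  push_cast
  rw [PositiveLinearMap.preGNS_norm_sq]
  simp

/-- Right multiplication `ρ(b) = b^op : x Ω ↦ x b Ω` on `L₂(M, τ)`. -/
def rightMul (b : M.toStarSubalgebra) : τ.L2 →L[ℂ] τ.L2 :=
  ((τ.toFun.toPreGNS.toLinearMap ∘ₗ LinearMap.mulRight ℂ b ∘ₗ
    τ.toFun.ofPreGNS.toLinearMap).mkContinuous ‖b‖ fun x =>
      τ.norm_mul_right_le (τ.toFun.ofPreGNS x) b).completion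

lemma leftMul_toL2 (a x : M.toStarSubalgebra) : τ.leftMul a (τ.toL2 x) = τ.toL2 (a * x) := by
  simp [leftMul, toL2]

lemma rightMul_toL2 (b x : M.toStarSubalgebra) : τ.rightMul b (τ.toL2 x) = τ.toL2 (x * b) := by
  simp only [rightMul, toL2, LinearMap.coe_mk, AddHom.coe_mk,
    ContinuousLinearMap.completion_apply_coe]
  rfl

end FaithfulNormalTrace

end Trace

/-! ### Spatial tensor products -/

section Tensor

variable {H₁ H₂ : Type*} [NormedAddCommGroup H₁] [InnerProductSpace ℂ H₁]
  [NormedAddCommGroup H₂] [InnerProductSpace ℂ H₂]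

variable (H₁ H₂) in
/-- The Hilbert space tensor product: the completion of the algebraic tensor product for
`⟨a ⊗ b, c ⊗ d⟩ = ⟨a, c⟩ ⟨b, d⟩`. -/
def HilbertTensor : Type _ := UniformSpace.Completion (H₁ ⊗[ℂ] H₂)

instance : NormedAddCommGroup (HilbertTensor H₁ H₂) :=
  inferInstanceAs (NormedAddCommGroup (UniformSpace.Completion (H₁ ⊗[ℂ] H₂)))

instance : InnerProductSpace ℂ (HilbertTensor H₁ H₂) :=
  inferInstanceAs (InnerProductSpace ℂ (UniformSpace.Completion (H₁ ⊗[ℂ] H₂)))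

instance : CompleteSpace (HilbertTensor H₁ H₂) :=
  inferInstanceAs (CompleteSpace (UniformSpace.Completion (H₁ ⊗[ℂ] H₂)))

/-- The canonical map from the algebraic tensor product. -/
def HilbertTensor.of : (H₁ ⊗[ℂ] H₂) →L[ℂ] HilbertTensor H₁ H₂ :=
  (UniformSpace.Completion.toComplL : (H₁ ⊗[ℂ] H₂) →L[ℂ] UniformSpace.Completion (H₁ ⊗[ℂ] H₂))

/-- The operator `x ⊗ y` on the Hilbert space tensor product. -/
def tensorOp (x : H₁ →L[ℂ] H₁) (y : H₂ →L[ℂ] H₂) :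
    HilbertTensor H₁ H₂ →L[ℂ] HilbertTensor H₁ H₂ :=
  (TensorProduct.mapL x y).completion

lemma tensorOp_of_tmul (x : H₁ →L[ℂ] H₁) (y : H₂ →L[ℂ] H₂) (ξ : H₁) (η : H₂) :
    tensorOp x y (HilbertTensor.of (ξ ⊗ₜ η)) = HilbertTensor.of (x ξ ⊗ₜ y η) :=
  ContinuousLinearMap.completion_apply_coe _ _

/-- The minimal (spatial) tensor product `A ⊗_min B` of unital C⋆-algebras of operators
`A ⊆ B(H₁)` and `B ⊆ B(H₂)`: the C⋆-algebra generated by the operators `x ⊗ y`, `x ∈ A`, `y ∈ B`.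
(As `A` and `B` contain `1`, the linear span of these operators is already a unital ⋆-algebra.) -/
def spatialTensor (A : Set (H₁ →L[ℂ] H₁)) (B : Set (H₂ →L[ℂ] H₂)) :
    StarSubalgebra ℂ (HilbertTensor H₁ H₂ →L[ℂ] HilbertTensor H₁ H₂) :=
  (StarAlgebra.adjoin ℂ {T | ∃ x ∈ A, ∃ y ∈ B, T = tensorOp x y}).topologicalClosure

instance spatialTensor_isClosed (A : Set (H₁ →L[ℂ] H₁)) (B : Set (H₂ →L[ℂ] H₂)) :
    IsClosed (spatialTensor A B : Set (HilbertTensor H₁ H₂ →L[ℂ] HilbertTensor H₁ H₂)) :=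
  StarSubalgebra.isClosed_topologicalClosure _

lemma tensorOp_mem_spatialTensor {A : Set (H₁ →L[ℂ] H₁)} {B : Set (H₂ →L[ℂ] H₂)}
    {x : H₁ →L[ℂ] H₁} {y : H₂ →L[ℂ] H₂} (hx : x ∈ A) (hy : y ∈ B) :
    tensorOp x y ∈ spatialTensor A B :=
  StarSubalgebra.le_topologicalClosure _ (StarAlgebra.subset_adjoin ℂ _ ⟨x, hx, y, hy, rfl⟩)

end Tensor

namespace FaithfulNormalTrace

variable {K : Type*} [NormedAddCommGroup K] [InnerProductSpace ℂ K] [CompleteSpace K]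
  {M : VonNeumannAlgebra K} (τ : FaithfulNormalTrace M)

/-- For a unital C⋆-subalgebra `A ⊆ M`, the minimal tensor product `A ⊗_min A^op`, where `A` and
`A^op` are faithfully represented on `L₂(M)` by left and right multiplication. It acts on the
coarse bimodule `L₂(M) ⊗ L₂(M)`. -/
abbrev minTensor (A : NonUnitalStarSubalgebra ℂ M.toStarSubalgebra) :
    StarSubalgebra ℂ (HilbertTensor τ.L2 τ.L2 →L[ℂ] HilbertTensor τ.L2 τ.L2) :=
  spatialTensor (τ.leftMul '' (A : Set M.toStarSubalgebra))
    (τ.rightMul '' (A : Set M.toStarSubalgebra))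

/-- The elementary tensor `a ⊗ b^op` as an element of `A ⊗_min A^op`. -/
def tmul {A : NonUnitalStarSubalgebra ℂ M.toStarSubalgebra} (a b : A) : τ.minTensor A :=
  ⟨tensorOp (τ.leftMul a) (τ.rightMul b),
    tensorOp_mem_spatialTensor ⟨a, a.2, rfl⟩ ⟨b, b.2, rfl⟩⟩

end FaithfulNormalTrace

/-! ### Bimodules and derivations -/

/-- An `𝒜`-`𝒜`-bimodule structure on a Hilbert space `H`: commuting ⋆-homomorphisms
`𝒜 → B(H)` and `𝒜^op → B(H)`. -/
structure HilbertBimodule (𝒜 : Type*) [NonUnitalRing 𝒜] [StarRing 𝒜] [Module ℂ 𝒜]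
    (H : Type*) [NormedAddCommGroup H] [InnerProductSpace ℂ H] [CompleteSpace H] where
  /-- the left action -/
  left : 𝒜 →⋆ₙₐ[ℂ] (H →L[ℂ] H)
  /-- the right action -/
  right : 𝒜ᵐᵒᵖ →⋆ₙₐ[ℂ] (H →L[ℂ] H)
  commute : ∀ x y, Commute (left x) (right y)

namespace HilbertBimodule

variable {𝒜 : Type*} [NonUnitalRing 𝒜] [StarRing 𝒜] [Module ℂ 𝒜]
  {H : Type*} [NormedAddCommGroup H] [InnerProductSpace ℂ H] [CompleteSpace H]

/-- The operator `x y^op : ξ ↦ x ξ y` on `H`. -/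
def act (π : HilbertBimodule 𝒜 H) (x y : 𝒜) : H →L[ℂ] H :=
  π.left x ∘L π.right (MulOpposite.op y)

/-- The Leibniz rule `∂(xy) = x ∂(y) + ∂(x) y`. -/
def IsDerivation (π : HilbertBimodule 𝒜 H) (δ : 𝒜 →ₗ[ℂ] H) : Prop :=
  ∀ x y, δ (x * y) = π.left x (δ y) + π.right (MulOpposite.op y) (δ x)

end HilbertBimodule

section Main

variable {K : Type*} [NormedAddCommGroup K] [InnerProductSpace ℂ K] [CompleteSpace K]
  {M : VonNeumannAlgebra K} (τ : FaithfulNormalTrace M)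
  {𝒜 : NonUnitalStarSubalgebra ℂ M.toStarSubalgebra}
  {H : Type*} [NormedAddCommGroup H] [InnerProductSpace ℂ H] [CompleteSpace H]

/-- Closability of `δ`, as a densely defined operator from `L₂(M)` to `H` with domain `𝒜Ω`:
the closure of its graph is again a graph. -/
def IsClosableOnL2 (δ : 𝒜 →ₗ[ℂ] H) : Prop :=
  ∀ ζ : H, ((0 : τ.L2), ζ) ∈ closure (Set.range fun a : 𝒜 => (τ.toL2 a, δ a)) → ζ = 0

open Classical in
/-- The linear map `𝒜 → H` with `e i ↦ δ(e i) / ‖δ(e i)‖` if `δ(e i) ≠ 0` and `e i ↦ u i`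
otherwise. -/
def normalizedDerivation {I : Type*} (δ : 𝒜 →ₗ[ℂ] H) (e : Module.Basis I ℂ 𝒜) (u : I → H) :
    𝒜 →ₗ[ℂ] H :=
  e.constr ℂ fun i => if δ (e i) = 0 then u i else ((‖δ (e i)‖⁻¹ : ℝ) : ℂ) • δ (e i)

/-- The operator `T_{x,y} : L₂(M) → H`, `ξ ↦ x S(ξ) y - S(x ξ y)`. -/
def commutatorT (π : HilbertBimodule 𝒜 H) (S : τ.L2 →L[ℂ] H) (x y : 𝒜) : τ.L2 →L[ℂ] H :=
  π.act x y ∘L S - S ∘L (τ.leftMul x ∘L τ.rightMul y)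

/-- `H` is weakly contained in the coarse bimodule of `M` as an `𝒜`-`𝒜`-bimodule: the assignment
`x ⊗ y^op ∈ B(L₂(M) ⊗ L₂(M)) ↦ x y^op ∈ B(H)` extends to a bounded ⋆-homomorphism on the
C⋆-algebra `A ⊗_min A^op` generated by the operators `x ⊗ y^op`, where `A` is the norm closure
of `𝒜`. The ⋆-homomorphism is not required to be unital, as `𝒜` may act degenerately on `H`. -/
def IsWeaklyContainedInCoarse (π : HilbertBimodule 𝒜 H) : Prop :=
  ∃ φ : τ.minTensor 𝒜.topologicalClosure →⋆ₙₐ[ℂ] (H →L[ℂ] H), Continuous φ ∧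
    ∀ x y : 𝒜,
      φ (τ.tmul ⟨x, 𝒜.le_topologicalClosure x.2⟩ ⟨y, 𝒜.le_topologicalClosure y.2⟩) = π.act x y

end Main

end

/-! Put `P = S⋆S`, write `c` for `ab^op` on `L₂(M)` and `C` for the operator of `a ⊗ b^op` on `H`.
Compactness of the operators `T_{x,y}` says that `S` intertwines `c` and `C` modulo compacts;
applied also to the adjoint pair, it shows that `P` essentially commutes with `c`
(`adjoint_comp_self_mem_essentialCommutant`). As `P` is Fredholm, functional calculus gives a
self-adjoint `R` with `RPR ≤ 1`, `RPR = 1` modulo compacts, and `R` again essentially commuting with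
`c` (`exists_essential_inv_sqrt`). Thus `W = SR` is the isometric part of `S` up to compacts, and `t
↦ W⋆φ(t)W` is a contractive completely positive map sending `a ⊗ b^op` to `ab^op` modulo compacts
(`isCompactOperator_compression_sub`).

This map need not be unital. Its defect `1 - W⋆φ(1)W` is positive and compact, hence `D⋆D` with `D`
compact. Adding `D⋆J⋆tJD`, for an isometry `J` of `L₂(M)` into the coarse bimodule, makes the map
unital and changes it only by compacts (`exists_unital_compact_correction`). -/

noncomputable section

/-! ### Matrix positivity and complete positivity of compressions. -/

section CStarMatrixPositivity

/-- A test element `N` for the positivity of a self-adjoint element `M` of a C⋆-algebra: its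
negative part. -/
lemma IsSelfAdjoint.exists_negative_test {B : Type*} [NonUnitalCStarAlgebra B] [PartialOrder B]
    [StarOrderedRing B] {M : B} (hM : IsSelfAdjoint M) :
    ∃ N R : B, star N = N ∧ M * N = -(N * N) ∧ N * (N * N) = star R * R ∧ (R = 0 → 0 ≤ M) := by
  have hN0 : 0 ≤ M⁻ := CFC.negPart_nonneg M
  have hNs : star M⁻ = M⁻ := hN0.isSelfAdjoint.star_eq
  have hMN : M * M⁻ = -(M⁻ * M⁻) := by
    have h1 := CFC.posPart_sub_negPart M hM
    calc M * M⁻ = (M⁺ - M⁻) * M⁻ := by rw [h1]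
      _ = -(M⁻ * M⁻) := by rw [sub_mul, CFC.posPart_mul_negPart, zero_sub]
  have hcube : 0 ≤ M⁻ * (M⁻ * M⁻) := by
    have := star_left_conjugate_nonneg hN0 M⁻
    rwa [hNs, mul_assoc] at this
  obtain ⟨R, hR⟩ := CStarAlgebra.nonneg_iff_eq_star_mul_self.mp hcube
  -- If `N³ = 0` then `(N²)⋆N² = 0`, so the C⋆-identity used twice gives `N = 0`.
  refine ⟨M⁻, R, hNs, hMN, hR, fun hR0 => ?_⟩
  have hN3 : M⁻ * (M⁻ * M⁻) = 0 := by rw [hR, hR0, mul_zero]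
  have hN2 : M⁻ * M⁻ = 0 := by
    rw [← CStarRing.star_mul_self_eq_zero_iff, star_mul, hNs, mul_assoc, hN3, mul_zero]
  have hN1 : M⁻ = 0 := by rw [← CStarRing.star_mul_self_eq_zero_iff, hNs, hN2]
  exact (CFC.negPart_eq_zero_iff M hM).mp hN1

/-- A self-adjoint matrix over a C⋆-algebra is positive as soon as all its "quadratic form values"
`∑ᵢⱼ vᵢ⋆ Mᵢⱼ vⱼ` are. -/
lemma CStarMatrix.nonneg_of_forall_sum_nonneg {n A : Type*} [Fintype n]
    [NonUnitalCStarAlgebra A] [PartialOrder A] [StarOrderedRing A] {M : CStarMatrix n n A}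
    (hM : IsSelfAdjoint M)
    (h : ∀ v : n → A, 0 ≤ ∑ i, ∑ j, star (v i) * M i j * v j) : 0 ≤ M := by
  obtain ⟨N, R, hNs, hMN, hR, hR0⟩ := hM.exists_negative_test
  refine hR0 ?_
  have hdiag : ∀ k, (star R * R) k k ≤ 0 := by
    intro k
    -- Testing on the `k`-th column of `N` gives the `k`-th diagonal entry of `NMN = -N³ = -R⋆R`. So
    -- `∑ᵢ Rᵢₖ⋆Rᵢₖ ≤ 0`, which kills column `k` of `R`.
    have h1 := h fun i => N i k
    have h2 : ∑ i, ∑ j, star (N i k) * M i j * N j k = (N * (M * N)) k k := by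
      simp only [CStarMatrix.mul_apply, Finset.mul_sum]
      refine Finset.sum_congr rfl fun i _ => Finset.sum_congr rfl fun j _ => ?_
      rw [← CStarMatrix.star_apply, hNs, mul_assoc]
    rw [h2, hMN, mul_neg, hR, CStarMatrix.neg_apply] at h1
    exact neg_nonneg.mp h1
  ext i k
  have h1 : (star R * R) k k = ∑ i, star (R i k) * R i k := by
    simp only [CStarMatrix.mul_apply, CStarMatrix.star_apply]
  have h2 := hdiag k
  rw [h1] at h2
  have h3 : ∀ i ∈ Finset.univ, 0 ≤ star (R i k) * R i k := fun i _ => star_mul_self_nonneg _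
  have h4 := (Finset.sum_eq_zero_iff_of_nonneg h3).mp (le_antisymm h2 (Finset.sum_nonneg h3))
  exact CStarRing.star_mul_self_eq_zero_iff _ |>.mp (h4 i (Finset.mem_univ i))

lemma CStarAlgebra.exists_eq_star_mul_self {B : Type*} [NonUnitalCStarAlgebra B] [PartialOrder B]
    [StarOrderedRing B] {M : B} (hM : 0 ≤ M) : ∃ N, M = star N * N :=
  CStarAlgebra.nonneg_iff_eq_star_mul_self.mp hM

variable {E F : Type*} [NormedAddCommGroup E] [InnerProductSpace ℂ E] [CompleteSpace E]
  [NormedAddCommGroup F] [InnerProductSpace ℂ F] [CompleteSpace F]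

open ContinuousLinearMap in
/-- The compression `T ↦ W⋆ T W`. -/
def ContinuousLinearMap.compression (W : E →L[ℂ] F) : (F →L[ℂ] F) →L[ℂ] (E →L[ℂ] E) :=
  (compL ℂ E F E (adjoint W)) ∘L ((compL ℂ E F F).flip W)

open ContinuousLinearMap in
lemma ContinuousLinearMap.compression_apply (W : E →L[ℂ] F) (T : F →L[ℂ] F) :
    W.compression T = adjoint W ∘L (T ∘L W) := rfl

-- With `M = N⋆N`, the quadratic form at `v` is `∑ₗ Tₗ⋆Tₗ`, where `Tₗ = ∑ᵢ Nₗᵢ W vᵢ`. This is how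
-- compressions are seen to be completely positive.
open ContinuousLinearMap in
lemma ContinuousLinearMap.compression_map_nonneg (W : E →L[ℂ] F) {k : ℕ}
    {M : CStarMatrix (Fin k) (Fin k) (F →L[ℂ] F)} (hM : 0 ≤ M) :
    0 ≤ M.map W.compression := by
  have hsa := hM.isSelfAdjoint.star_eq
  obtain ⟨N, hN⟩ := CStarAlgebra.exists_eq_star_mul_self hM
  refine CStarMatrix.nonneg_of_forall_sum_nonneg ?_ fun v => ?_
  · ext i j : 2
    rw [CStarMatrix.star_apply, CStarMatrix.map_apply, CStarMatrix.map_apply]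
    have h1 : M i j = star (M j i) := by rw [← CStarMatrix.star_apply, hsa]
    rw [h1]
    simp only [compression_apply, star_eq_adjoint, adjoint_comp, adjoint_adjoint, comp_assoc]
  · have key : ∑ i, ∑ j, star (v i) * M.map W.compression i j * v j =
        ∑ l, adjoint (∑ i, N l i ∘L W ∘L v i) ∘L (∑ i, N l i ∘L W ∘L v i) := by
      have h1 : ∀ i j, star (v i) * M.map W.compression i j * v j =
          ∑ l, adjoint (N l i ∘L W ∘L v i) ∘L (N l j ∘L W ∘L v j) := by
        intro i j
        rw [CStarMatrix.map_apply, hN, CStarMatrix.mul_apply, map_sum, Finset.mul_sum,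
          Finset.sum_mul]
        refine Finset.sum_congr rfl fun l _ => ?_
        rw [CStarMatrix.star_apply]
        simp only [compression_apply, star_eq_adjoint, adjoint_comp, comp_assoc, mul_def]
      simp only [h1]
      rw [Finset.sum_congr rfl fun i _ => Finset.sum_comm, Finset.sum_comm]
      refine Finset.sum_congr rfl fun l _ => ?_
      rw [map_sum]
      ext x
      simp only [sum_apply, comp_apply, map_sum]
      rw [Finset.sum_comm]
    rw [key]
    refine Finset.sum_nonneg fun l _ => ?_
    rw [nonneg_iff_isPositive]
    exact isPositive_adjoint_comp_self _

/-- The sum of the compressions of two ⋆-homomorphisms is completely positive. -/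
def compressionSum {G A : Type*} [NormedAddCommGroup G] [InnerProductSpace ℂ G] [CompleteSpace G]
    [NonUnitalCStarAlgebra A] [PartialOrder A] [StarOrderedRing A]
    (φ : A →⋆ₙₐ[ℂ] (F →L[ℂ] F)) (V : E →L[ℂ] F) (ψ : A →⋆ₙₐ[ℂ] (G →L[ℂ] G)) (W : E →L[ℂ] G) :
    A →CP (E →L[ℂ] E) where
  toLinearMap := V.compression.toLinearMap ∘ₗ (φ : A →ₗ[ℂ] (F →L[ℂ] F)) +
    W.compression.toLinearMap ∘ₗ (ψ : A →ₗ[ℂ] (G →L[ℂ] G))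
  map_cstarMatrix_nonneg' k M hM :=
    add_nonneg
      (V.compression_map_nonneg (CompletelyPositiveMapClass.map_cstarMatrix_nonneg' φ k M hM))
      (W.compression_map_nonneg (CompletelyPositiveMapClass.map_cstarMatrix_nonneg' ψ k M hM))

lemma compressionSum_apply {G A : Type*} [NormedAddCommGroup G] [InnerProductSpace ℂ G]
    [CompleteSpace G] [NonUnitalCStarAlgebra A] [PartialOrder A] [StarOrderedRing A]
    (φ : A →⋆ₙₐ[ℂ] (F →L[ℂ] F)) (V : E →L[ℂ] F) (ψ : A →⋆ₙₐ[ℂ] (G →L[ℂ] G)) (W : E →L[ℂ] G)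
    (t : A) :
    compressionSum φ V ψ W t = V.compression (φ t) + W.compression (ψ t) := rfl

end CStarMatrixPositivity

/-! ### Compact operators, essential commutants and the essential inverse square root. -/

section Compact

variable {E F : Type*} [NormedAddCommGroup E] [InnerProductSpace ℂ E] [CompleteSpace E]
  [NormedAddCommGroup F] [InnerProductSpace ℂ F] [CompleteSpace F]

open ContinuousLinearMap Filter Topology

/-- An operator `T` between Hilbert spaces is compact if `T⋆ T` is. -/
lemma IsCompactOperator.of_adjoint_comp_self {T : E →L[ℂ] F}
    (h : IsCompactOperator (adjoint T ∘L T)) : IsCompactOperator T := by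
  have hrw : IsCompactOperator T ↔ IsCompactOperator (T : E →ₗ[ℂ] F) := Iff.rfl
  rw [hrw, isCompactOperator_iff_isCompact_closure_image_closedBall (T : E →ₗ[ℂ] F) zero_lt_one]
  refine TotallyBounded.isCompact_of_isClosed (TotallyBounded.closure ?_) isClosed_closure
  have hT := (IsCompactOperator.isCompact_closure_image_closedBall
    (f := ((adjoint T ∘L T : E →L[ℂ] E) : E →ₗ[ℂ] E)) h 1).totallyBounded
  have hT' := TotallyBounded.subset subset_closure hT
  rw [Metric.totallyBounded_iff]
  intro ε hε
  -- Since `‖Tz‖² ≤ ‖T⋆Tz‖ ‖z‖` and differences of points of the unit ball have norm at most `2`, an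
  -- `ε²/2`-net for `T⋆T` of the ball lifts to an `ε`-net for `T` of the ball.
  obtain ⟨t, hts, htf, htc⟩ :=
    Metric.finite_approx_of_totallyBounded hT' (ε ^ 2 / 2) (by positivity)
  have hts' : ∀ y ∈ t, ∃ z ∈ Metric.closedBall (0 : E) 1, (adjoint T) (T z) = y := fun y hy =>
    hts hy
  choose! s hs1 hs2 using hts'
  refine ⟨(fun y => T (s y)) '' t, htf.image _, ?_⟩
  rintro _ ⟨x, hx, rfl⟩
  obtain ⟨y, hy, hxy⟩ := Set.mem_iUnion₂.mp (htc ⟨x, hx, rfl⟩)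
  refine Set.mem_iUnion₂.mpr ⟨_, ⟨y, hy, rfl⟩, ?_⟩
  rw [Metric.mem_ball, dist_eq_norm] at hxy ⊢
  have hn : ‖x - s y‖ ≤ 2 := by
    have h1 := mem_closedBall_zero_iff.mp hx
    have h2 := mem_closedBall_zero_iff.mp (hs1 y hy)
    linarith [norm_sub_le x (s y)]
  have h2 : (adjoint T) (T (s y)) = y := hs2 y hy
  rw [← h2] at hxy
  have hxy' : ‖(adjoint T) (T (x - s y))‖ < ε ^ 2 / 2 := by simpa using hxy
  have h3 : ‖T (x - s y)‖ ^ 2 ≤ ‖(adjoint T) (T (x - s y))‖ * ‖x - s y‖ := by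
    rw [← inner_self_eq_norm_sq (𝕜 := ℂ), ← adjoint_inner_left]
    exact (RCLike.re_le_norm _).trans (norm_inner_le_norm _ _)
  have h4 : ‖T (x - s y)‖ ^ 2 < ε ^ 2 := by
    nlinarith [norm_nonneg ((adjoint T) (T (x - s y)))]
  have h5 := lt_of_pow_lt_pow_left₀ 2 hε.le h4
  simpa using h5

/-- The adjoint of a compact operator between Hilbert spaces is compact. -/
lemma IsCompactOperator.adjoint {T : E →L[ℂ] F} (h : IsCompactOperator T) :
    IsCompactOperator (ContinuousLinearMap.adjoint T) := by
  refine IsCompactOperator.of_adjoint_comp_self ?_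
  rw [adjoint_adjoint]
  exact h.comp_clm (ContinuousLinearMap.adjoint T)

/-- The operators which commute with `c` modulo the compact operators, together with their
adjoints. -/
def essentialCommutant (c : E →L[ℂ] E) : StarSubalgebra ℂ (E →L[ℂ] E) where
  carrier := {T | IsCompactOperator (T * c - c * T) ∧ IsCompactOperator (star T * c - c * star T)}
  mul_mem' := by
    have key : ∀ S T : E →L[ℂ] E, IsCompactOperator (S * c - c * S) →
        IsCompactOperator (T * c - c * T) → IsCompactOperator (S * T * c - c * (S * T)) := by
      intro S T hS hT
      have : S * T * c - c * (S * T) = S * (T * c - c * T) + (S * c - c * S) * T := by noncomm_ring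
      rw [this]
      exact (hT.clm_comp S).add (hS.comp_clm T)
    rintro S T ⟨hS, hS'⟩ ⟨hT, hT'⟩
    exact ⟨key S T hS hT, by rw [star_mul]; exact key _ _ hT' hS'⟩
  add_mem' := by
    have key : ∀ S T : E →L[ℂ] E, IsCompactOperator (S * c - c * S) →
        IsCompactOperator (T * c - c * T) → IsCompactOperator ((S + T) * c - c * (S + T)) := by
      intro S T hS hT
      have : (S + T) * c - c * (S + T) = (S * c - c * S) + (T * c - c * T) := by noncomm_ring
      rw [this]
      exact hS.add hT
    rintro S T ⟨hS, hS'⟩ ⟨hT, hT'⟩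
    exact ⟨key S T hS hT, by rw [star_add]; exact key _ _ hS' hT'⟩
  algebraMap_mem' r := by
    have key : ∀ r : ℂ, IsCompactOperator
        (algebraMap ℂ (E →L[ℂ] E) r * c - c * algebraMap ℂ (E →L[ℂ] E) r) := by
      intro r
      rw [Algebra.commutes, sub_self]
      exact isCompactOperator_zero
    exact ⟨key r, by rw [← algebraMap_star_comm]; exact key _⟩
  star_mem' := by
    rintro T ⟨hT, hT'⟩
    exact ⟨hT', by rwa [star_star]⟩

/-- Closedness is what lets the continuous functional calculus of a self-adjoint element stay in the
essential commutant. -/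
instance essentialCommutant_isClosed (c : E →L[ℂ] E) :
    IsClosed (essentialCommutant c : Set (E →L[ℂ] E)) := by
  have h : IsClosed {T : E →L[ℂ] E | IsCompactOperator T} := isClosed_setOfPred_isCompactOperator
  exact (h.preimage (f := fun T => T * c - c * T) (by fun_prop)).inter
    (h.preimage (f := fun T => star T * c - c * star T) (by fun_prop))

/-- If `S` intertwines `c` and `C`, and also their adjoints, modulo the compact operators, then
`S⋆ S` commutes with `c` modulo the compact operators. -/
lemma adjoint_comp_self_mem_essentialCommutant {S : E →L[ℂ] F} {c : E →L[ℂ] E} {C : F →L[ℂ] F}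
    (h : IsCompactOperator (C ∘L S - S ∘L c : E →L[ℂ] F))
    (h' : IsCompactOperator (star C ∘L S - S ∘L star c : E →L[ℂ] F)) :
    adjoint S ∘L S ∈ essentialCommutant c := by
  have h1 : IsCompactOperator (adjoint S ∘L (C ∘L S - S ∘L c) : E →L[ℂ] E) :=
    h.clm_comp (adjoint S)
  have h2 : IsCompactOperator (adjoint (star C ∘L S - S ∘L star c) ∘L S : E →L[ℂ] E) :=
    h'.adjoint.comp_clm S
  have h3 : IsCompactOperator
      ((adjoint S ∘L S) * c - c * (adjoint S ∘L S) : E →L[ℂ] E) := by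
    -- Both `S⋆Sc` and `cS⋆S` are compared with `S⋆CS`.
    have h4 : (adjoint S ∘L S) * c - c * (adjoint S ∘L S) =
        adjoint (star C ∘L S - S ∘L star c) ∘L S - adjoint S ∘L (C ∘L S - S ∘L c) := by
      simp only [star_eq_adjoint, map_sub, adjoint_comp, adjoint_adjoint, comp_sub, sub_comp,
        mul_def, comp_assoc]
      abel
    rw [h4]
    exact h2.sub h1
  have h5 : star (adjoint S ∘L S) = adjoint S ∘L S := by
    rw [star_eq_adjoint, adjoint_comp, adjoint_adjoint]
  exact ⟨h3, by rwa [h5]⟩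

/-- A bounded operator with finite dimensional range is compact. -/
lemma ContinuousLinearMap.isCompactOperator_of_hasFiniteRange {E F : Type*}
    [NormedAddCommGroup E] [NormedSpace ℂ E] [NormedAddCommGroup F] [NormedSpace ℂ F] (T : E →L[ℂ] F)
    (h : (T : E →ₗ[ℂ] F).HasFiniteRange) : IsCompactOperator T := by
  have : FiniteDimensional ℂ (T : E →ₗ[ℂ] F).range := Module.Finite.iff_fg.mpr h
  let T' : E →L[ℂ] (T : E →ₗ[ℂ] F).range := T.codRestrict _ fun x => LinearMap.mem_range_self _ x
  have h1 : IsCompactOperator T' := by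
    have : ProperSpace (T : E →ₗ[ℂ] F).range := FiniteDimensional.proper ℂ _
    exact isCompactOperator_of_locallyCompactSpace_dom T'
  exact h1.clm_comp ((T : E →ₗ[ℂ] F).range.subtypeL)

/-- A positive Fredholm operator `P` has an "essential inverse square root" `R` in its continuous
functional calculus. -/
lemma exists_essential_inv_sqrt {P : E →L[ℂ] E} (hP : 0 ≤ P) (hF : P.IsFredholm) :
    ∃ R : E →L[ℂ] E, IsSelfAdjoint R ∧ R * P * R ≤ 1 ∧ IsCompactOperator (1 - R * P * R : E →L[ℂ] E) ∧
      ∀ c : E →L[ℂ] E, P ∈ essentialCommutant c → R ∈ essentialCommutant c := by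
  obtain ⟨Q, hQ, -⟩ := hF.exists_isQuasiInverse
  have hK : IsCompactOperator (Q * P - 1 : E →L[ℂ] E) := by
    have h1 := LinearMap.FiniteRangeSetoid.equiv_iff_hasFiniteRange.mp hQ.equiv
    exact (Q * P - 1 : E →L[ℂ] E).isCompactOperator_of_hasFiniteRange h1
  -- The cut-off `ε` is below `1/‖Q‖`, which bounds from below the essential spectrum of `P`.
  obtain ⟨ε, hε, hεQ⟩ : ∃ ε : ℝ, 0 < ε ∧ ‖Q‖ * ε < 1 := by
    refine ⟨(‖Q‖ + 1)⁻¹, by positivity, ?_⟩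
    rw [← div_eq_mul_inv, div_lt_one (by positivity)]
    linarith
  -- The inverse square root, truncated below `ε` to be continuous. The defect `h` vanishes for `t ≥
  -- ε` and lies in `[0, 1]` for `t ≥ 0`.
  set g : ℝ → ℝ := fun t => (Real.sqrt (max t ε))⁻¹ with hg
  set h : ℝ → ℝ := fun t => 1 - g t * t * g t with hh
  have hm : ∀ t, 0 < max t ε := fun t => lt_max_of_lt_right hε
  have hgc : Continuous g := by
    refine Continuous.inv₀ (by fun_prop) fun t => (Real.sqrt_pos.mpr (hm t)).ne'
  have hhc : Continuous h := by fun_prop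
  have hh' : ∀ t, h t = 1 - t / max t ε := by
    intro t
    have h1 : g t * g t = (max t ε)⁻¹ := by
      rw [hg, ← mul_inv, Real.mul_self_sqrt (hm t).le]
    rw [hh, div_eq_mul_inv, ← h1]
    ring
  have hsa : IsSelfAdjoint P := hP.isSelfAdjoint
  set R := cfc g P with hR
  have hRP : 1 - R * P * R = cfc h P := by
    rw [hh, cfc_sub (fun _ => (1:ℝ)) _ P (by fun_prop) (by fun_prop), cfc_const_one ℝ P,
      cfc_mul (fun t => g t * t) g P (by fun_prop) (by fun_prop),
      cfc_mul g (fun t => t) P (by fun_prop) (by fun_prop), cfc_id' ℝ P]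
  have hspec : ∀ t ∈ spectrum ℝ P, 0 ≤ t := fun t ht => spectrum_nonneg_of_nonneg hP ht
  have hh0 : ∀ t, 0 ≤ t → 0 ≤ h t ∧ h t ≤ 1 := by
    intro t ht
    rw [hh']
    have h1 : t / max t ε ≤ 1 := (div_le_one (hm t)).mpr (le_max_left _ _)
    have h2 : 0 ≤ t / max t ε := div_nonneg ht (hm t).le
    constructor <;> linarith
  refine ⟨R, cfc_predicate g P, ?_, ?_, fun c hc => cfc_mem g hc⟩
  · rw [← sub_nonneg, hRP]
    exact cfc_nonneg fun t ht => (hh0 t (hspec t ht)).1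
  · rw [hRP]
    -- Modulo compacts `QP = 1`, so `h(P) = QⁿPⁿh(P)`. The right side has norm at most `(‖Q‖ε)ⁿ`,
    -- because `h` lives on `t < ε`; hence `h(P)` is a norm limit of compacts.
    have hpow : ∀ n : ℕ, IsCompactOperator (cfc h P - Q ^ n * (P ^ n * cfc h P) : E →L[ℂ] E) := by
      intro n
      induction n with
      | zero => simpa using isCompactOperator_zero
      | succ n ih =>
        have : cfc h P - Q ^ (n + 1) * (P ^ (n + 1) * cfc h P) =
            (cfc h P - Q ^ n * (P ^ n * cfc h P)) -
              Q ^ n * ((Q * P - 1) * (P ^ n * cfc h P)) := by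
          rw [pow_succ Q, pow_succ' P]; noncomm_ring
        rw [this]
        exact ih.sub ((hK.comp_clm (P ^ n * cfc h P)).clm_comp (Q ^ n))
    have hnorm : ∀ n : ℕ, ‖Q ^ n * (P ^ n * cfc h P)‖ ≤ (‖Q‖ * ε) ^ n := by
      intro n
      have h1 : P ^ n * cfc h P = cfc (fun t => t ^ n * h t) P := by
        rw [cfc_mul (fun t => t ^ n) h P (by fun_prop) (by fun_prop), cfc_pow_id P n]
      have h2 : ‖P ^ n * cfc h P‖ ≤ ε ^ n := by
        rw [h1]
        refine norm_cfc_le (by positivity) fun t ht => ?_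
        have h0 := hspec t ht
        obtain ⟨h3, h4⟩ := hh0 t h0
        rw [Real.norm_eq_abs, abs_of_nonneg (by positivity)]
        rcases le_total t ε with h5 | h5
        · calc t ^ n * h t ≤ ε ^ n * 1 := by gcongr
            _ = ε ^ n := mul_one _
        · rw [hh', max_eq_left h5, div_self (by linarith), sub_self, mul_zero]
          positivity
      have h3 : ∀ (n : ℕ) (X : E →L[ℂ] E), ‖Q ^ n * X‖ ≤ ‖Q‖ ^ n * ‖X‖ := by
        intro n X
        induction n with
        | zero => simp
        | succ n ih =>
          rw [pow_succ', mul_assoc, pow_succ', mul_assoc]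
          exact (norm_mul_le _ _).trans (by gcongr)
      rw [mul_pow]
      exact (h3 n _).trans (by gcongr)
    have hlim : Tendsto (fun n : ℕ => cfc h P - Q ^ n * (P ^ n * cfc h P)) atTop
        (𝓝 (cfc h P)) := by
      have h0 : Tendsto (fun n : ℕ => Q ^ n * (P ^ n * cfc h P)) atTop (𝓝 0) :=
        squeeze_zero_norm hnorm (tendsto_pow_atTop_nhds_zero_of_lt_one (by positivity) hεQ)
      simpa using tendsto_const_nhds.sub h0
    exact isCompactOperator_of_tendsto hlim (Eventually.of_forall hpow)

end Compact

/-! ### Operators on the Hilbert space tensor product. -/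

section HilbertTensor

variable {H₁ H₂ : Type*} [NormedAddCommGroup H₁] [InnerProductSpace ℂ H₁]
  [NormedAddCommGroup H₂] [InnerProductSpace ℂ H₂]

open ContinuousLinearMap

lemma HilbertTensor.denseRange_of : DenseRange (HilbertTensor.of : (H₁ ⊗[ℂ] H₂) →L[ℂ] _) :=
  UniformSpace.Completion.denseRange_coe

lemma tensorOp_of (x : H₁ →L[ℂ] H₁) (y : H₂ →L[ℂ] H₂) (z : H₁ ⊗[ℂ] H₂) :
    tensorOp x y (HilbertTensor.of z) = HilbertTensor.of (TensorProduct.mapL x y z) :=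
  ContinuousLinearMap.completion_apply_coe _ _

lemma HilbertTensor.hom_ext {S T : HilbertTensor H₁ H₂ →L[ℂ] HilbertTensor H₁ H₂}
    (h : ∀ z, S (HilbertTensor.of z) = T (HilbertTensor.of z)) : S = T := by
  refine DFunLike.coe_injective ?_
  exact HilbertTensor.denseRange_of.equalizer S.continuous T.continuous (funext h)

lemma tensorOp_sub_left (x x' : H₁ →L[ℂ] H₁) (y : H₂ →L[ℂ] H₂) :
    tensorOp (x - x') y = tensorOp x y - tensorOp x' y := by
  refine HilbertTensor.hom_ext fun z => ?_
  have h : TensorProduct.mapL (x - x') y = TensorProduct.mapL x y - TensorProduct.mapL x' y :=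
    eq_sub_of_add_eq (by rw [← TensorProduct.mapL_add_left, sub_add_cancel])
  rw [sub_apply, tensorOp_of, tensorOp_of, tensorOp_of, ← map_sub, h, sub_apply]

lemma tensorOp_sub_right (x : H₁ →L[ℂ] H₁) (y y' : H₂ →L[ℂ] H₂) :
    tensorOp x (y - y') = tensorOp x y - tensorOp x y' := by
  refine HilbertTensor.hom_ext fun z => ?_
  have h : TensorProduct.mapL x (y - y') = TensorProduct.mapL x y - TensorProduct.mapL x y' :=
    eq_sub_of_add_eq (by rw [← TensorProduct.mapL_add_right, sub_add_cancel])
  rw [sub_apply, tensorOp_of, tensorOp_of, tensorOp_of, ← map_sub, h, sub_apply]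

lemma tensorOp_one_one : tensorOp (1 : H₁ →L[ℂ] H₁) (1 : H₂ →L[ℂ] H₂) = 1 := by
  refine HilbertTensor.hom_ext fun z => ?_
  rw [tensorOp_of]
  exact congrArg (fun T => HilbertTensor.of (T z)) TensorProduct.mapL_id_id

lemma norm_tensorOp_le (x : H₁ →L[ℂ] H₁) (y : H₂ →L[ℂ] H₂) : ‖tensorOp x y‖ ≤ ‖x‖ * ‖y‖ := by
  refine opNorm_le_bound _ (by positivity) fun w => ?_
  have hcl : IsClosed {w | ‖tensorOp x y w‖ ≤ ‖x‖ * ‖y‖ * ‖w‖} :=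
    isClosed_le (by fun_prop) (by fun_prop)
  refine (HilbertTensor.denseRange_of.induction_on (p := fun w =>
    ‖tensorOp x y w‖ ≤ ‖x‖ * ‖y‖ * ‖w‖) w hcl fun z => ?_)
  have hn : ∀ z : H₁ ⊗[ℂ] H₂, ‖HilbertTensor.of z‖ = ‖z‖ := UniformSpace.Completion.norm_coe
  rw [tensorOp_of, hn, hn]
  exact (le_opNorm _ _).trans (by gcongr; exact TensorProduct.norm_mapL_le x y)

/-- The operator `x ⊗ y` depends continuously on `x` and `y`. -/
lemma continuous_tensorOp :
    Continuous fun p : (H₁ →L[ℂ] H₁) × (H₂ →L[ℂ] H₂) => tensorOp p.1 p.2 := by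
  rw [continuous_iff_continuousAt]
  rintro ⟨x, y⟩
  rw [ContinuousAt, tendsto_iff_norm_sub_tendsto_zero]
  have hbound : ∀ p : (H₁ →L[ℂ] H₁) × (H₂ →L[ℂ] H₂),
      ‖tensorOp p.1 p.2 - tensorOp x y‖ ≤ ‖p.1 - x‖ * ‖p.2‖ + ‖x‖ * ‖p.2 - y‖ := by
    intro p
    have : tensorOp p.1 p.2 - tensorOp x y = tensorOp (p.1 - x) p.2 + tensorOp x (p.2 - y) := by
      rw [tensorOp_sub_left, tensorOp_sub_right]; abel
    rw [this]
    exact (norm_add_le _ _).trans (add_le_add (norm_tensorOp_le _ _) (norm_tensorOp_le _ _))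
  refine squeeze_zero (fun _ => norm_nonneg _) hbound ?_
  have hc : Continuous fun p : (H₁ →L[ℂ] H₁) × (H₂ →L[ℂ] H₂) =>
      ‖p.1 - x‖ * ‖p.2‖ + ‖x‖ * ‖p.2 - y‖ := by fun_prop
  simpa using hc.tendsto (x, y)

/-- If `H₂` is nonzero, `H₁` embeds isometrically in `H₁ ⊗ H₂`. -/
lemma HilbertTensor.exists_adjoint_comp_eq_one [CompleteSpace H₁] [Nontrivial H₂] :
    ∃ J : H₁ →L[ℂ] HilbertTensor H₁ H₂, adjoint J ∘L J = 1 := by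
  -- The embedding is `ξ ↦ ξ ⊗ η` for a unit vector `η`.
  obtain ⟨η, hη⟩ := exists_norm_eq H₂ zero_le_one
  let J₀ : H₁ →ₗ[ℂ] HilbertTensor H₁ H₂ :=
    (HilbertTensor.of : (H₁ ⊗[ℂ] H₂) →L[ℂ] _).toLinearMap ∘ₗ (TensorProduct.mk ℂ H₁ H₂).flip η
  have hJ : ∀ ξ, ‖J₀ ξ‖ = ‖ξ‖ := by
    intro ξ
    have : ‖HilbertTensor.of (ξ ⊗ₜ[ℂ] η)‖ = ‖ξ ⊗ₜ[ℂ] η‖ := UniformSpace.Completion.norm_coe _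
    exact this.trans (by rw [TensorProduct.norm_tmul, hη, mul_one])
  let J : H₁ →ₗᵢ[ℂ] HilbertTensor H₁ H₂ := ⟨J₀, hJ⟩
  exact ⟨J.toContinuousLinearMap, (norm_map_iff_adjoint_comp_self _).mp J.norm_map⟩

end HilbertTensor

/-! ### Left and right multiplication on `L₂(M)`. -/

namespace FaithfulNormalTrace

variable {K : Type*} [NormedAddCommGroup K] [InnerProductSpace ℂ K] [CompleteSpace K]
  {M : VonNeumannAlgebra K} (τ : FaithfulNormalTrace M)

open ContinuousLinearMap

lemma denseRange_toL2 : DenseRange τ.toL2 :=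
  UniformSpace.Completion.denseRange_coe (α := τ.toFun.PreGNS)

lemma inner_toL2 (x y : M.toStarSubalgebra) : ⟪τ.toL2 x, τ.toL2 y⟫_ℂ = τ.toFun (star x * y) :=
  UniformSpace.Completion.inner_coe (E := τ.toFun.PreGNS) _ _

lemma hom_ext {S T : τ.L2 →L[ℂ] τ.L2} (h : ∀ x, S (τ.toL2 x) = T (τ.toL2 x)) : S = T :=
  DFunLike.coe_injective (τ.denseRange_toL2.equalizer S.continuous T.continuous (funext h))

lemma rightMul_sub (b c : M.toStarSubalgebra) :
    τ.rightMul (b - c) = τ.rightMul b - τ.rightMul c := by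
  refine τ.hom_ext fun x => ?_
  rw [sub_apply, rightMul_toL2, rightMul_toL2, rightMul_toL2, mul_sub, map_sub]

lemma rightMul_one : τ.rightMul 1 = 1 := by
  refine τ.hom_ext fun x => ?_
  rw [rightMul_toL2, mul_one]
  rfl

lemma leftMul_one : τ.leftMul 1 = 1 := map_one τ.toFun.gnsStarAlgHom

lemma norm_rightMul_le (b : M.toStarSubalgebra) : ‖τ.rightMul b‖ ≤ ‖b‖ := by
  refine opNorm_le_bound _ (norm_nonneg b) fun w => ?_
  refine τ.denseRange_toL2.induction_on (p := fun w => ‖τ.rightMul b w‖ ≤ ‖b‖ * ‖w‖) w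
    (isClosed_le (by fun_prop) (by fun_prop)) fun x => ?_
  rw [rightMul_toL2]
  have hn : ∀ x, ‖τ.toL2 x‖ = ‖τ.toFun.toPreGNS x‖ := fun x => UniformSpace.Completion.norm_coe _
  rw [hn, hn]
  exact τ.norm_mul_right_le x b

lemma continuous_rightMul : Continuous τ.rightMul := by
  refine LipschitzWith.continuous (K := 1) (LipschitzWith.of_dist_le_mul fun b c => ?_)
  rw [dist_eq_norm, dist_eq_norm, ← rightMul_sub, NNReal.coe_one, one_mul]
  exact τ.norm_rightMul_le _

lemma continuous_leftMul : Continuous τ.leftMul :=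
  map_continuous τ.toFun.gnsStarAlgHom

/-- This is traciality: `τ((xb⋆)⋆y) = τ(bx⋆y) = τ(x⋆yb)`. -/
lemma star_rightMul (b : M.toStarSubalgebra) : star (τ.rightMul b) = τ.rightMul (star b) := by
  rw [star_eq_adjoint]
  refine ((eq_adjoint_iff _ _).mpr fun x y => ?_).symm
  refine τ.denseRange_toL2.induction_on₂ (p := fun x y =>
    ⟪τ.rightMul (star b) x, y⟫_ℂ = ⟪x, τ.rightMul b y⟫_ℂ)
    (isClosed_eq (by fun_prop) (by fun_prop)) (fun x y => ?_) x y
  rw [rightMul_toL2, rightMul_toL2, inner_toL2, inner_toL2, star_mul, star_star, mul_assoc,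
    τ.tracial, mul_assoc]

lemma star_leftMul (a : M.toStarSubalgebra) : star (τ.leftMul a) = τ.leftMul (star a) :=
  (map_star τ.toFun.gnsStarAlgHom a).symm

lemma leftMul_comp_rightMul (a b : M.toStarSubalgebra) :
    τ.leftMul a ∘L τ.rightMul b = τ.rightMul b ∘L τ.leftMul a := by
  refine τ.hom_ext fun x => ?_
  simp only [comp_apply, leftMul_toL2, rightMul_toL2, mul_assoc]

lemma star_leftMul_comp_rightMul (a b : M.toStarSubalgebra) :
    star (τ.leftMul a ∘L τ.rightMul b) = τ.leftMul (star a) ∘L τ.rightMul (star b) := by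
  rw [leftMul_comp_rightMul, ← star_leftMul, ← star_rightMul]
  exact star_mul _ _

lemma continuous_tmul (A : NonUnitalStarSubalgebra ℂ M.toStarSubalgebra) :
    Continuous fun p : A × A => τ.tmul p.1 p.2 := by
  refine Continuous.subtype_mk (continuous_tensorOp.comp (Continuous.prodMk ?_ ?_)) _
  · exact τ.continuous_leftMul.comp (continuous_subtype_val.comp continuous_fst)
  · exact τ.continuous_rightMul.comp (continuous_subtype_val.comp continuous_snd)

lemma continuous_leftMul_comp_rightMul (A : NonUnitalStarSubalgebra ℂ M.toStarSubalgebra) :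
    Continuous fun p : A × A => τ.leftMul p.1 ∘L τ.rightMul p.2 :=
  (τ.continuous_leftMul.comp (continuous_subtype_val.comp continuous_fst)).clm_comp
    (τ.continuous_rightMul.comp (continuous_subtype_val.comp continuous_snd))

lemma tmul_one_one {A : NonUnitalStarSubalgebra ℂ M.toStarSubalgebra}
    (h : (1 : M.toStarSubalgebra) ∈ A) : τ.tmul (⟨1, h⟩ : A) ⟨1, h⟩ = 1 := by
  refine Subtype.ext ?_
  change tensorOp (τ.leftMul 1) (τ.rightMul 1) = 1
  rw [leftMul_one, rightMul_one, tensorOp_one_one]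

end FaithfulNormalTrace

/-! ### Adjoints of the bimodule operators, and passage to the norm closure. -/

namespace HilbertBimodule

variable {𝒜 : Type*} [NonUnitalRing 𝒜] [StarRing 𝒜] [Module ℂ 𝒜]
  {H : Type*} [NormedAddCommGroup H] [InnerProductSpace ℂ H] [CompleteSpace H]

lemma star_act (π : HilbertBimodule 𝒜 H) (x y : 𝒜) :
    star (π.act x y) = π.act (star x) (star y) := by
  have h := π.commute (star x) (MulOpposite.op (star y))
  change star (π.left x * π.right (MulOpposite.op y)) =
    π.left (star x) * π.right (MulOpposite.op (star y))
  rw [h.eq, star_mul, ← map_star, ← map_star]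
  rfl

end HilbertBimodule

section Commutator

variable {K : Type*} [NormedAddCommGroup K] [InnerProductSpace ℂ K] [CompleteSpace K]
  {M : VonNeumannAlgebra K} (τ : FaithfulNormalTrace M)
  {𝒜 : NonUnitalStarSubalgebra ℂ M.toStarSubalgebra}
  {H : Type*} [NormedAddCommGroup H] [InnerProductSpace ℂ H] [CompleteSpace H]

/-- The left and right actions commute, so `(xy^op)⋆ = x⋆(y⋆)^op` on both spaces. Hence compactness
for all pairs also covers the intertwining of adjoints. -/
lemma commutatorT_star (π : HilbertBimodule 𝒜 H) (S : τ.L2 →L[ℂ] H) (x y : 𝒜) :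
    commutatorT τ π S (star x) (star y) =
      star (π.act x y) ∘L S - S ∘L star (τ.leftMul x ∘L τ.rightMul y) := by
  rw [commutatorT, π.star_act, τ.star_leftMul_comp_rightMul]
  rfl

end Commutator

section Density

variable {K : Type*} [NormedAddCommGroup K] [InnerProductSpace ℂ K] [CompleteSpace K]
  {M : VonNeumannAlgebra K}

lemma NonUnitalStarSubalgebra.dense_range_prod_topologicalClosure
    (𝒜 : NonUnitalStarSubalgebra ℂ M.toStarSubalgebra) :
    Dense (Set.range fun q : 𝒜 × 𝒜 =>
      ((⟨q.1, 𝒜.le_topologicalClosure q.1.2⟩, ⟨q.2, 𝒜.le_topologicalClosure q.2.2⟩) :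
        𝒜.topologicalClosure × 𝒜.topologicalClosure)) := by
  have hd : DenseRange fun x : 𝒜 =>
      (⟨x, 𝒜.le_topologicalClosure x.2⟩ : 𝒜.topologicalClosure) := by
    intro a
    rw [closure_subtype]
    have h1 : (a : M.toStarSubalgebra) ∈ closure (𝒜 : Set M.toStarSubalgebra) := a.2
    refine closure_mono ?_ h1
    intro x hx
    exact ⟨_, ⟨⟨x, hx⟩, rfl⟩, rfl⟩
  exact hd.prodMap hd

end Density

/-! ### From an essential intertwiner to a unital completely positive map. -/

section Correction

variable {E F : Type*} [NormedAddCommGroup E] [InnerProductSpace ℂ E] [CompleteSpace E]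
  [NormedAddCommGroup F] [InnerProductSpace ℂ F] [CompleteSpace F]

open ContinuousLinearMap

/-- If `S` intertwines `c` and `C` modulo the compact operators, then so does `S R`, where `R` is
an essential inverse square root of `S⋆ S` that essentially commutes with `c`. -/
lemma isCompactOperator_compression_sub {S : E →L[ℂ] F} {c R : E →L[ℂ] E} {C : F →L[ℂ] F}
    (h : IsCompactOperator (C ∘L S - S ∘L c : E →L[ℂ] F)) (hR : IsSelfAdjoint R)
    (hRc : R ∈ essentialCommutant c)
    (hRP : IsCompactOperator (1 - R * (adjoint S ∘L S) * R : E →L[ℂ] E)) :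
    IsCompactOperator ((S ∘L R).compression C - c : E →L[ℂ] E) := by
  have h1 : IsCompactOperator ((R ∘L adjoint S) ∘L (C ∘L S - S ∘L c) ∘L R : E →L[ℂ] E) :=
    (h.comp_clm R).clm_comp (R ∘L adjoint S)
  have h2 : IsCompactOperator ((R * (adjoint S ∘L S)) * (R * c - c * R) : E →L[ℂ] E) :=
    hRc.1.clm_comp (R * (adjoint S ∘L S))
  have h3 : IsCompactOperator ((1 - R * (adjoint S ∘L S) * R) * c : E →L[ℂ] E) := hRP.comp_clm c
  have hRs : adjoint R = R := hR
  -- With `P = S⋆S`, the chain modulo compacts is `RS⋆CSR ≈ RPcR ≈ RPRc ≈ c`, one term for each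
  -- link.
  have key : (S ∘L R).compression C - c =
      (R ∘L adjoint S) ∘L (C ∘L S - S ∘L c) ∘L R - (R * (adjoint S ∘L S)) * (R * c - c * R) -
        (1 - R * (adjoint S ∘L S) * R) * c := by
    simp only [compression_apply, adjoint_comp, hRs, comp_sub, sub_comp, mul_def, comp_assoc,
      one_def, id_comp]
    abel
  rw [key]
  exact (h1.sub h2).sub h3

/-- A compression of a projection by `W` with `W⋆ W ≤ 1` is at most `1`. -/
lemma compression_le_one {W : E →L[ℂ] F} (hW : adjoint W ∘L W ≤ 1) {q : F →L[ℂ] F}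
    (hq : IsStarProjection q) : W.compression q ≤ 1 := by
  refine le_trans ?_ hW
  rw [← sub_nonneg]
  have h1 : adjoint W ∘L W - W.compression q = adjoint W ∘L (1 - q) ∘L W := by
    simp only [compression_apply, comp_sub, sub_comp, one_def, id_comp]
  rw [h1, nonneg_iff_isPositive]
  exact ((nonneg_iff_isPositive _).mp hq.one_sub.nonneg).adjoint_conj W

/-- A contractive completely positive map `W⋆ φ(·) W` which is unital modulo the compact operators
can be corrected to a unital completely positive map. -/
lemma exists_unital_compact_correction {G A : Type*} [NormedAddCommGroup G]
    [InnerProductSpace ℂ G] [CompleteSpace G] [CStarAlgebra A] [PartialOrder A] [StarOrderedRing A]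
    (φ : A →⋆ₙₐ[ℂ] (F →L[ℂ] F)) {W : E →L[ℂ] F} (hW : adjoint W ∘L W ≤ 1)
    (hc : IsCompactOperator (W.compression (φ 1) - 1 : E →L[ℂ] E))
    (ψ : A →⋆ₐ[ℂ] (G →L[ℂ] G)) {J : E →L[ℂ] G} (hJ : adjoint J ∘L J = 1) :
    ∃ θ : A →CP (E →L[ℂ] E), θ 1 = 1 ∧
      ∀ t, IsCompactOperator (θ t - W.compression (φ t) : E →L[ℂ] E) := by
  -- As `φ` need not be unital, `φ 1` is only a projection.
  have hq : IsStarProjection (φ 1) := (IsStarProjection.one A).map φ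
  obtain ⟨D, hD⟩ := CStarAlgebra.exists_eq_star_mul_self
    (sub_nonneg.mpr (compression_le_one hW hq))
  have hDc : IsCompactOperator D := by
    refine IsCompactOperator.of_adjoint_comp_self ?_
    have h1 : adjoint D ∘L D = -(W.compression (φ 1) - 1) := by
      rw [neg_sub]; exact hD.symm
    rw [h1]
    exact hc.neg
  -- At `1` the second summand is `D⋆J⋆JD = D⋆D`, exactly the missing `1 - W⋆φ(1)W`; at every `t` it
  -- is compact because `D` is.
  refine ⟨compressionSum φ W (ψ : A →⋆ₙₐ[ℂ] (G →L[ℂ] G)) (J ∘L D), ?_, fun t => ?_⟩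
  · have h1 : (J ∘L D).compression (ψ 1) = star D * D := by
      rw [map_one, compression_apply, one_def, id_comp, adjoint_comp, comp_assoc,
        ← comp_assoc (adjoint J), hJ, one_def, id_comp]
      rfl
    rw [compressionSum_apply]
    change _ + (J ∘L D).compression (ψ 1) = 1
    rw [h1, ← hD, add_sub_cancel]
  · rw [compressionSum_apply, add_sub_cancel_left]
    exact ((hDc.clm_comp J).clm_comp (ψ t)).clm_comp (adjoint (J ∘L D))

/-- If `S : E → F` with `S⋆ S` Fredholm intertwines, modulo the compact operators, a family
`c x` on `E` and the images `φ (t x)` of a family in a C⋆-algebra `A`, then `t x ↦ c x` extends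
modulo the compact operators to a unital completely positive map. -/
theorem exists_unital_cp_of_essential_intertwiner {G A X : Type*} [NormedAddCommGroup G]
    [InnerProductSpace ℂ G] [CompleteSpace G] [CStarAlgebra A] [PartialOrder A] [StarOrderedRing A]
    [TopologicalSpace X] (φ : A →⋆ₙₐ[ℂ] (F →L[ℂ] F)) (hφ : Continuous φ)
    (ψ : A →⋆ₐ[ℂ] (G →L[ℂ] G)) (hJ : Nontrivial E → ∃ J : E →L[ℂ] G, adjoint J ∘L J = 1)
    {S : E →L[ℂ] F} (hS : (adjoint S ∘L S).IsFredholm)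
    {t : X → A} (ht : Continuous t) {c : X → E →L[ℂ] E} (hc : Continuous c)
    {s : Set X} (hs : Dense s)
    (h : ∀ x ∈ s, IsCompactOperator (φ (t x) ∘L S - S ∘L c x : E →L[ℂ] F))
    (h' : ∀ x ∈ s, IsCompactOperator (star (φ (t x)) ∘L S - S ∘L star (c x) : E →L[ℂ] F))
    {x₁ : X} (ht₁ : t x₁ = 1) (hc₁ : c x₁ = 1) :
    ∃ θ : A →CP (E →L[ℂ] E), θ 1 = 1 ∧
      ∀ x, IsCompactOperator (θ (t x) - c x : E →L[ℂ] E) := by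
  have hP0 : 0 ≤ adjoint S ∘L S :=
    (nonneg_iff_isPositive _).mpr (isPositive_adjoint_comp_self S)
  obtain ⟨R, hR, hRle, hRP, hRc⟩ := exists_essential_inv_sqrt hP0 hS
  have hRs : adjoint R = R := hR
  -- The hypotheses hold only on the dense set `s`, which need not contain `x₁`. Norm closedness of
  -- the compacts extends the conclusion to all of `X` before it is evaluated at `x₁`.
  have hcl : IsClosed
      {x | IsCompactOperator ((S ∘L R).compression (φ (t x)) - c x : E →L[ℂ] E)} := by
    have h1 : IsClosed {T : E →L[ℂ] E | IsCompactOperator T} :=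
      isClosed_setOfPred_isCompactOperator
    exact h1.preimage (((S ∘L R).compression.continuous.comp (hφ.comp ht)).sub hc)
  have hcpt (x : X) : IsCompactOperator ((S ∘L R).compression (φ (t x)) - c x : E →L[ℂ] E) := by
    refine closure_minimal (fun x hx => ?_) hcl (hs x)
    exact isCompactOperator_compression_sub (h x hx) hR
      (hRc _ (adjoint_comp_self_mem_essentialCommutant (h x hx) (h' x hx))) hRP
  -- The isometry `J` is only available for `E ≠ 0`; on the zero space every map works.
  rcases subsingleton_or_nontrivial E with hsub | hnt
  · refine ⟨compressionSum φ 0 φ 0, Subsingleton.elim _ _, fun x => ?_⟩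
    rw [Subsingleton.elim (compressionSum φ (0 : E →L[ℂ] F) φ (0 : E →L[ℂ] F) (t x) - c x) 0]
    exact isCompactOperator_zero
  · obtain ⟨J, hJ⟩ := hJ hnt
    have hW : adjoint (S ∘L R) ∘L (S ∘L R) ≤ 1 := by
      rw [adjoint_comp, hRs]
      exact hRle
    have hc1 : IsCompactOperator ((S ∘L R).compression (φ 1) - 1 : E →L[ℂ] E) := by
      have := hcpt x₁
      rwa [ht₁, hc₁] at this
    obtain ⟨θ, hθ1, hθ⟩ := exists_unital_compact_correction φ hW hc1 ψ hJ
    refine ⟨θ, hθ1, fun x => ?_⟩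
    rw [← sub_add_sub_cancel _ ((S ∘L R).compression (φ (t x)))]
    exact (hθ (t x)).add (hcpt x)

end Correction

end

/-! ### Application to `L₂(M)` and the coarse bimodule. -/

theorem mainTheorem6
    {K : Type*} [NormedAddCommGroup K] [InnerProductSpace ℂ K] [CompleteSpace K]
    (M : VonNeumannAlgebra K) (τ : FaithfulNormalTrace M)
    (𝒜 : NonUnitalStarSubalgebra ℂ M.toStarSubalgebra)
    (h_dense : IsSigmaWeaklyDense 𝒜)
    (h_one : (1 : M.toStarSubalgebra) ∈ 𝒜.topologicalClosure)
    {H : Type*} [NormedAddCommGroup H] [InnerProductSpace ℂ H] [CompleteSpace H]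
    (π : HilbertBimodule 𝒜 H)
    (δ : 𝒜 →ₗ[ℂ] H) (h_der : π.IsDerivation δ) (h_closable : IsClosableOnL2 τ δ)
    {I : Type*} [Countable I] (e : Module.Basis I ℂ 𝒜)
    (h_orth : Orthonormal ℂ fun i => τ.toL2 (e i))
    (u : I → H) (h_unit : ∀ i, δ (e i) = 0 → ‖u i‖ = 1)
    (S : τ.L2 →L[ℂ] H)
    (h_S : ∀ a : 𝒜, S (τ.toL2 a) = normalizedDerivation δ e u a)
    (h_Fredholm : (ContinuousLinearMap.adjoint S ∘L S).IsFredholm)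
    (h_compact : ∀ x y : 𝒜, IsCompactOperator (commutatorT τ π S x y))
    (h_weak : IsWeaklyContainedInCoarse τ π) :
    ∃ θ : τ.minTensor 𝒜.topologicalClosure →CP (τ.L2 →L[ℂ] τ.L2),
      θ 1 = 1 ∧
      ∀ a b : 𝒜.topologicalClosure,
        IsCompactOperator (θ (τ.tmul a b) - τ.leftMul a ∘L τ.rightMul b) := by
  obtain ⟨φ, hφc, hφ⟩ := h_weak
  refine (exists_unital_cp_of_essential_intertwiner φ hφc
    (τ.minTensor 𝒜.topologicalClosure).subtype
    (fun _ => HilbertTensor.exists_adjoint_comp_eq_one) h_Fredholm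
    (τ.continuous_tmul 𝒜.topologicalClosure)
    (τ.continuous_leftMul_comp_rightMul 𝒜.topologicalClosure)
    (NonUnitalStarSubalgebra.dense_range_prod_topologicalClosure 𝒜)
    ?_ ?_ (x₁ := (⟨1, h_one⟩, ⟨1, h_one⟩)) ?_ ?_).imp
    fun θ hθ => ⟨hθ.1, fun a b => hθ.2 (a, b)⟩
  · refine Set.forall_mem_range.mpr fun q => ?_
    have h := h_compact q.1 q.2
    rw [commutatorT, ← hφ] at h
    exact h
  · refine Set.forall_mem_range.mpr fun q => ?_
    have h := h_compact (star q.1) (star q.2)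
    rw [commutatorT_star, ← hφ] at h
    exact h
  · exact τ.tmul_one_one h_one
  · change τ.leftMul 1 ∘L τ.rightMul 1 = 1
    rw [τ.leftMul_one, τ.rightMul_one]
    rfl
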